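/- Let $n\in\mathbb N$, let $H$ be a complex Hilbert space and let $T=(T_1,\dots,T_n)\in L(H)^n$ be a commuting tuple of bounded linear operators. For $z\in\mathbb C^n$ let $T-Z: H^n\to H$ denote the row operator $(h_i)_{i=1}^n\mapsto\sum_{i=1}^n (T_i-z_i)h_i$ on the Hilbert space direct sum $H^n$; for $z=0$ this is the row operator $T:H^n\to H$. Let $W(T)=H\ominus\sum_{i=1}^n T_iH$. Suppose that $T$ is regular at $z=0$, that is, there is $\epsilon>0$ such that for all $z\in\mathbb C^n$ with Euclidean norm $\|z\|<\epsilon$ the subspace $(T-Z)H^n\subset H$ is closed and $H$ is the algebraic direct sum $H=(T-Z)H^n\oplus W(T)$. Then the row operator $T:H^n\to H$ is a partial isometry if and only if there is an orthogonal decomposition $H=H_0\oplus H_1$ into closed subspaces such that $T=T_0\oplus T_1$ with $T_0\in L(H_0)^n$ and $T_1\in L(H_1)^n$, where $T_0$ is a spherical coisometry (a commuting tuple with $\sum_{i=1}^n T_{0,i}T_{0,i}^*=1_{H_0}$) and $T_1$ is, for some complex Hilbert space $\mathcal D$, unitarily equivalent to the tuple $M_z=(M_{z_1},\dots,M_{z_n})$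 of multiplications by the coordinate functions on $H_1(\mathbb B,\mathcal D)$, the $\mathcal D$-valued functional Hilbert space on the open Euclidean unit ball $\mathbb B\subset\mathbb C^n$ with reproducing kernel $K(z,w)=(1-\langle z,w\rangle)^{-1}1_{\mathcal D}$, $\langle z,w\rangle=\sum_{i=1}^n z_i\overline{w_i}$. -/

import Mathlib

universe u

/-! Commuting tuples on a Hilbert space -/

section Tuples

variable {n : ℕ} {H : Type*} [NormedAddCommGroup H] [InnerProductSpace ℂ H]

/-- The tuple `T = (T_1, …, T_n)` consists of pairwise commuting operators. -/
def IsCommutingTuple (T : Fin n → H →L[ℂ] H) : Prop :=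
  ∀ i j, T i ∘L T j = T j ∘L T i

/-- The row operator `H^n → H`, `(h_i) ↦ ∑ i, T_i h_i`; here `H^n` is the Hilbert space direct sum. -/
noncomputable def rowOperator (T : Fin n → H →L[ℂ] H) :
    PiLp 2 (fun _ : Fin n => H) →L[ℂ] H :=
  ∑ i, T i ∘L PiLp.proj 2 (fun _ : Fin n => H) i

/-- The tuple `T - z = (T_1 - z_1, …, T_n - z_n)`. -/
noncomputable def translateTuple (T : Fin n → H →L[ℂ] H) (z : EuclideanSpace ℂ (Fin n)) :
    Fin n → H →L[ℂ] H :=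
  fun i => T i - z i • ContinuousLinearMap.id ℂ H

/-- The wandering subspace `W(T) = H ⊖ ∑ i, T_i H`. -/
noncomputable def wanderingSubspace (T : Fin n → H →L[ℂ] H) : Submodule ℂ H :=
  (rowOperator T).rangeᗮ

/-- `T` is regular at `z = 0`: for all `z` in some ball around `0`, the space `(T - z) H^n` is closed
and `H` is the algebraic direct sum of `(T - z) H^n` and `W(T)`. -/
def IsRegularAtZero (T : Fin n → H →L[ℂ] H) : Prop :=
  ∃ ε : ℝ, 0 < ε ∧ ∀ z : EuclideanSpace ℂ (Fin n), ‖z‖ < ε →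
    IsClosed ((rowOperator (translateTuple T z)).range : Set H) ∧
    IsCompl (rowOperator (translateTuple T z)).range (wanderingSubspace T)

/-- A partial isometry: an operator that is isometric on the orthogonal complement of its kernel. -/
def IsPartialIsometry {E F : Type*} [NormedAddCommGroup E] [InnerProductSpace ℂ E]
    [NormedAddCommGroup F] [InnerProductSpace ℂ F] (A : E →L[ℂ] F) : Prop :=
  ∀ x ∈ A.kerᗮ, ‖A x‖ = ‖x‖

/-- A spherical isometry: a commuting tuple `S` with `∑ i, S_i^* S_i = 1`. -/
def IsSphericalIsometry [CompleteSpace H] (S : Fin n → H →L[ℂ] H) : Prop :=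
  IsCommutingTuple S ∧
    ∑ i, ContinuousLinearMap.adjoint (S i) ∘L S i = ContinuousLinearMap.id ℂ H

/-- A spherical coisometry: a commuting tuple whose tuple of adjoints is a spherical isometry. -/
def IsSphericalCoisometry [CompleteSpace H] (S : Fin n → H →L[ℂ] H) : Prop :=
  IsCommutingTuple S ∧ IsSphericalIsometry (fun i => ContinuousLinearMap.adjoint (S i))

/-- `T = T₀ ⊕ T₁` with respect to the orthogonal decomposition `H = H₀ ⊕ H₀ᗮ`. -/
def IsOrthogonalDirectSum (T : Fin n → H →L[ℂ] H) (H₀ : Submodule ℂ H)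
    (T₀ : Fin n → H₀ →L[ℂ] H₀) (T₁ : Fin n → H₀ᗮ →L[ℂ] H₀ᗮ) : Prop :=
  ∀ i, ∀ (x : H₀) (y : H₀ᗮ), T i ((x : H) + (y : H)) = (T₀ i x : H) + (T₁ i y : H)

end Tuples

/-! The vector-valued Drury–Arveson space -/

/-- The open Euclidean unit ball in `ℂ^n`. -/
abbrev unitBall (n : ℕ) : Type := Metric.ball (0 : EuclideanSpace ℂ (Fin n)) 1

section DruryArveson

variable (n : ℕ) (D : Type*) [NormedAddCommGroup D] [InnerProductSpace ℂ D]

/-- The kernel `K(z, w) = (1 - ∑ i, z_i * conj w_i)⁻¹ • 1_D`.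
(Mathlib's inner product is conjugate linear in the first argument.) -/
noncomputable def druryArvesonKernel : Matrix (unitBall n) (unitBall n) (D →L[ℂ] D) :=
  Matrix.of fun z w => (1 - inner ℂ w.1 z.1)⁻¹ • ContinuousLinearMap.id ℂ D

theorem druryArvesonKernel_posSemidef [CompleteSpace D] :
    (druryArvesonKernel n D).PosSemidef := by
  have htfae := (RKHS.posSemidef_tfae (K := druryArvesonKernel n D)).out 0 2
  rw [htfae]
  refine ⟨?_, fun f => ?_⟩
  · ext z w : 2
    simp [druryArvesonKernel, Matrix.conjTranspose_apply, star_smul,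
      ← ContinuousLinearMap.one_def]
  · let m : (k : ℕ) → (Fin k → Fin n) → unitBall n → ℂ := fun k s x => ∏ j, star (x.1 (s j))
    have key : ∀ x y : unitBall n, HasSum
        (fun k : ℕ => ∑ s : Fin k → Fin n,
          inner ℂ (m k s x • f x) (m k s y • f y))
        (inner ℂ (druryArvesonKernel n D y x (f x)) (f y)) := by
      intro x y
      have hx : ‖x.1‖ < 1 := mem_ball_zero_iff.mp x.2
      have hy : ‖y.1‖ < 1 := mem_ball_zero_iff.mp y.2
      have h1 : ‖(inner ℂ y.1 x.1 : ℂ)‖ < 1 :=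
        (norm_inner_le_norm _ _).trans_lt
          (mul_lt_one_of_nonneg_of_lt_one_left (norm_nonneg _) hy hx.le)
      have h2 := (hasSum_geometric_of_norm_lt_one h1).mul_right (inner ℂ (f x) (f y))
      have e1 : (fun k : ℕ => ∑ s : Fin k → Fin n,
          (inner ℂ (m k s x • f x) (m k s y • f y) : ℂ))
          = fun k => (inner ℂ y.1 x.1 : ℂ) ^ k * inner ℂ (f x) (f y) := by
        funext k
        have h3 : (inner ℂ y.1 x.1 : ℂ) ^ k
            = ∑ s : Fin k → Fin n, ∏ j, (x.1 (s j) * star (y.1 (s j))) := by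
          rw [← Fintype.prod_sum (fun (_ : Fin k) (i : Fin n) => x.1 i * star (y.1 i))]
          simp [PiLp.inner_apply]
        rw [h3, Finset.sum_mul]
        refine Finset.sum_congr rfl fun s _ => ?_
        simp only [m, inner_smul_left, inner_smul_right, map_prod, Finset.prod_mul_distrib]
        simp
        ring
      have e2 : (inner ℂ (druryArvesonKernel n D y x (f x)) (f y) : ℂ)
          = (1 - inner ℂ y.1 x.1)⁻¹ * inner ℂ (f x) (f y) := by
        simp [druryArvesonKernel, mul_comm]
      rw [e1, e2]
      exact h2
    have tot : HasSum
        (fun k : ℕ => ∑ x ∈ f.support, ∑ y ∈ f.support, ∑ s : Fin k → Fin n,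
          (inner ℂ (m k s x • f x) (m k s y • f y) : ℂ))
        (f.sum fun x w => f.sum fun y w' =>
          (inner ℂ (druryArvesonKernel n D y x w) w' : ℂ)) :=
      hasSum_sum fun x _ => hasSum_sum fun y _ => key x y
    have tot' := Complex.hasSum_re tot
    refine tot'.nonneg fun k => ?_
    have : ∑ x ∈ f.support, ∑ y ∈ f.support, ∑ s : Fin k → Fin n,
          (inner ℂ (m k s x • f x) (m k s y • f y) : ℂ)
        = ∑ s : Fin k → Fin n, inner ℂ (∑ x ∈ f.support, m k s x • f x)
            (∑ x ∈ f.support, m k s x • f x) := by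
      simp only [sum_inner, inner_sum]
      rw [Finset.sum_comm]
      simp_rw [Finset.sum_comm (s := f.support) (t := Finset.univ)]
    rw [this, Complex.re_sum]
    exact Finset.sum_nonneg fun s _ => inner_self_nonneg (𝕜 := ℂ)

instance druryArvesonKernel_fact [CompleteSpace D] : Fact (druryArvesonKernel n D).PosSemidef :=
  ⟨druryArvesonKernel_posSemidef n D⟩

/-- The `D`-valued Drury–Arveson space `H_1(𝔹, D)`: the reproducing kernel Hilbert space of `D`-valued
functions on the unit ball with kernel `(1 - ⟨z, w⟩)⁻¹ • 1_D`. -/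
abbrev DruryArvesonSpace [CompleteSpace D] := RKHS.OfKernel (druryArvesonKernel n D)

end DruryArveson

/-- The tuple `S` is unitarily equivalent to the tuple `M_z = (M_{z_1}, …, M_{z_n})` of
multiplications by the coordinate functions on `H_1(𝔹, D)`: there is a unitary `U` with
`U S_i = M_{z_i} U`, that is, `(U (S_i x))(z) = z_i (U x)(z)`. -/
def IsUnitarilyEquivalentToShift {n : ℕ} {E : Type*} [NormedAddCommGroup E]
    [InnerProductSpace ℂ E] (S : Fin n → E →L[ℂ] E)
    (D : Type*) [NormedAddCommGroup D] [InnerProductSpace ℂ D] [CompleteSpace D] : Prop :=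
  ∃ U : E ≃ₗᵢ[ℂ] DruryArvesonSpace n D,
    ∀ (i : Fin n) (x : E) (z : unitBall n), U (S i x) z = z.1 i • U x z

/-! Suppose the row operator is a partial isometry. Its adjoint is contractive, so A_z = ∑ z_i T_i^*
has norm at most ‖z‖ and F_z = P_W (1 - A_z)⁻¹ (`modelEval`) exists on the whole ball. Regularity
gives F_z T_i = z_i F_z (`modelEval_apply_eq_smul`), hence F_z F_w^* = (1 - ⟨z,w⟩)⁻¹
(`modelEval_adjoint_modelEval`). So x ↦ (z ↦ F_z x) is a coisometry onto the Drury–Arveson space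
over W(T) which intertwines T_i with M_{z_i}. Its kernel reduces T and is orthogonal to W(T), so it
lies in the closed range of the row operator, where ∑ T_i T_i^* acts as the identity. This kernel is
H₀, and its complement carries the shift.

Conversely, A is a partial isometry exactly when A A^* A = A. This relation passes to direct sums;
it is clear for spherical coisometries and is checked on kernel functions for the shift. -/

/-! ### Partial isometries -/

open ContinuousLinearMap in
theorem adjoint_apply_mem_orthogonal_ker {E F : Type*} [NormedAddCommGroup E]
    [InnerProductSpace ℂ E] [NormedAddCommGroup F] [InnerProductSpace ℂ F] [CompleteSpace E]
    [CompleteSpace F] (A : E →L[ℂ] F) (y : F) : adjoint A y ∈ A.kerᗮ := by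
  rw [Submodule.mem_orthogonal]
  intro u hu
  rw [adjoint_inner_right, show A u = 0 from hu, inner_zero_left]

open ContinuousLinearMap in
theorem IsPartialIsometry.norm_adjoint_apply_le {E F : Type*} [NormedAddCommGroup E]
    [InnerProductSpace ℂ E] [NormedAddCommGroup F] [InnerProductSpace ℂ F] [CompleteSpace E]
    [CompleteSpace F] {A : E →L[ℂ] F} (hA : IsPartialIsometry A) (y : F) :
    ‖adjoint A y‖ ≤ ‖y‖ := by
  have h1 : ‖adjoint A y‖ * ‖adjoint A y‖ ≤ ‖adjoint A y‖ * ‖y‖ := by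
    have h2 : RCLike.re (inner ℂ (A (adjoint A y)) y) = ‖adjoint A y‖ * ‖adjoint A y‖ := by
      rw [← adjoint_inner_right, inner_self_eq_norm_mul_norm]
    rw [← h2, ← hA _ (adjoint_apply_mem_orthogonal_ker A y)]
    exact re_inner_le_norm _ _
  by_cases h0 : ‖adjoint A y‖ = 0
  · rw [h0]; positivity
  · exact le_of_mul_le_mul_left h1 (lt_of_le_of_ne (norm_nonneg _) (Ne.symm h0))

-- For y in the complement of the kernel, ‖A^*Ay - y‖² = ‖A^*Ay‖² - 2‖Ay‖² + ‖y‖² ≤ 0, as A^* is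
-- contractive. Conversely, A^*Ax - x lies both in the kernel and in its complement.
open ContinuousLinearMap in
theorem isPartialIsometry_iff {E F : Type*} [NormedAddCommGroup E] [InnerProductSpace ℂ E]
    [NormedAddCommGroup F] [InnerProductSpace ℂ F] [CompleteSpace E] [CompleteSpace F]
    (A : E →L[ℂ] F) :
    IsPartialIsometry A ↔ ∀ x, A (adjoint A (A x)) = A x := by
  constructor
  · intro h x
    have hfix : ∀ y ∈ A.kerᗮ, adjoint A (A y) = y := fun y hy => by
      have h1 := @norm_sub_sq ℂ E _ _ _ (adjoint A (A y)) y
      rw [adjoint_inner_left, inner_self_eq_norm_sq, h y hy] at h1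
      have h2 : ‖adjoint A (A y)‖ ^ 2 ≤ ‖y‖ ^ 2 := by
        gcongr
        exact (h.norm_adjoint_apply_le _).trans (h y hy).le
      have h3 : ‖adjoint A (A y) - y‖ ^ 2 = 0 := le_antisymm (by linarith) (sq_nonneg _)
      exact sub_eq_zero.mp (norm_eq_zero.mp (pow_eq_zero_iff two_ne_zero |>.mp h3))
    have : CompleteSpace A.ker := A.isClosed_ker.completeSpace_coe
    obtain ⟨k, hk, m, hm, rfl⟩ := A.ker.exists_add_mem_mem_orthogonal x
    rw [map_add, show A k = 0 from hk, zero_add, hfix m hm]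
  · intro h x hx
    have h1 : adjoint A (A x) - x ∈ A.ker := by
      change A _ = 0
      rw [map_sub, h, sub_self]
    have h2 : adjoint A (A x) = x := by
      refine sub_eq_zero.mp ?_
      exact (Submodule.disjoint_def.mp A.ker.orthogonal_disjoint) _ h1
        (Submodule.sub_mem _ (adjoint_apply_mem_orthogonal_ker A _) hx)
    have h3 : ‖A x‖ ^ 2 = ‖x‖ ^ 2 := by
      rw [← @inner_self_eq_norm_sq ℂ F, ← adjoint_inner_left, h2, inner_self_eq_norm_sq]
    exact (sq_eq_sq₀ (norm_nonneg _) (norm_nonneg _)).mp h3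

/-! ### Unitaries from equal Gram matrices -/

theorem denseRange_linearCombination {ι G : Type*} [NormedAddCommGroup G]
    [InnerProductSpace ℂ G] [CompleteSpace G] (w : ι → G)
    (hw : ∀ x, (∀ i, inner ℂ (w i) x = 0) → x = 0) :
    DenseRange (Finsupp.linearCombination ℂ w) := by
  have h1 : (LinearMap.range (Finsupp.linearCombination ℂ w)).topologicalClosure = ⊤ := by
    rw [Submodule.topologicalClosure_eq_top_iff, Submodule.eq_bot_iff]
    intro x hx
    exact hw x fun i => (Submodule.mem_orthogonal _ _).mp hx _ ⟨Finsupp.single i 1, by simp⟩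
  have h2 := Submodule.dense_iff_topologicalClosure_eq_top.mpr h1
  rwa [LinearMap.coe_range] at h2

/-- Two total families with the same Gram matrix are unitarily equivalent. -/
theorem exists_linearIsometryEquiv_of_inner_eq {ι E F : Type*} [NormedAddCommGroup E]
    [InnerProductSpace ℂ E] [NormedAddCommGroup F] [InnerProductSpace ℂ F] [CompleteSpace E]
    [CompleteSpace F] (v : ι → E) (u : ι → F)
    (hv : ∀ x, (∀ i, inner ℂ (v i) x = 0) → x = 0) (hu : ∀ x, (∀ i, inner ℂ (u i) x = 0) → x = 0)
    (h : ∀ i j, (inner ℂ (v i) (v j) : ℂ) = inner ℂ (u i) (u j)) :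
    ∃ U : E ≃ₗᵢ[ℂ] F, ∀ i, U (v i) = u i := by
  have hdv := denseRange_linearCombination v hv
  have hdu := denseRange_linearCombination u hu
  have hnorm : ∀ c : ι →₀ ℂ,
      ‖Finsupp.linearCombination ℂ u c‖ = ‖Finsupp.linearCombination ℂ v c‖ := by
    intro c
    refine (sq_eq_sq₀ (norm_nonneg _) (norm_nonneg _)).mp ?_
    rw [← @inner_self_eq_norm_sq ℂ E, ← @inner_self_eq_norm_sq ℂ F]
    simp only [Finsupp.linearCombination_apply, Finsupp.sum_inner, Finsupp.inner_sum,
      inner_smul_left, inner_smul_right, h]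
  refine ⟨(LinearEquiv.refl ℂ (ι →₀ ℂ)).extendOfIsometry (Finsupp.linearCombination ℂ v)
    (Finsupp.linearCombination ℂ u) hdv hdu hnorm, fun i => ?_⟩
  have := LinearEquiv.extendOfIsometry_eq (LinearEquiv.refl ℂ (ι →₀ ℂ))
    (Finsupp.linearCombination ℂ v) (Finsupp.linearCombination ℂ u) hdv hdu
    hnorm (Finsupp.single i 1)
  simpa using this

/-! ### The row operator and its adjoint -/

section RowOperator

variable {n : ℕ} {H : Type*} [NormedAddCommGroup H] [InnerProductSpace ℂ H]

open ContinuousLinearMap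

theorem rowOperator_apply (T : Fin n → H →L[ℂ] H) (y : PiLp 2 (fun _ : Fin n => H)) :
    rowOperator T y = ∑ i, T i (y i) := by
  simp [rowOperator]

theorem rowOperator_single (T : Fin n → H →L[ℂ] H) (i : Fin n) (x : H) :
    rowOperator T (WithLp.toLp 2 (Pi.single i x)) = T i x := by
  classical
  rw [rowOperator_apply, Finset.sum_eq_single i]
  · simp
  · intro j _ hj
    simp [Pi.single_eq_of_ne hj]
  · simp

theorem rowOperator_translateTuple_apply (T : Fin n → H →L[ℂ] H) (z : EuclideanSpace ℂ (Fin n))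
    (y : PiLp 2 (fun _ : Fin n => H)) :
    rowOperator (translateTuple T z) y = rowOperator T y - ∑ i, z i • y i := by
  simp [rowOperator_apply, translateTuple]

theorem translateTuple_zero (T : Fin n → H →L[ℂ] H) : translateTuple T 0 = T := by
  funext i
  simp [translateTuple]

theorem adjoint_rowOperator_apply [CompleteSpace H] (T : Fin n → H →L[ℂ] H) (h : H) (i : Fin n) :
    adjoint (rowOperator T) h i = adjoint (T i) h := by
  classical
  refine ext_inner_left ℂ fun x => ?_
  have h1 : inner ℂ (WithLp.toLp 2 (Pi.single i x) : PiLp 2 (fun _ : Fin n => H))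
      (adjoint (rowOperator T) h) = inner ℂ x (adjoint (rowOperator T) h i) := by
    rw [PiLp.inner_apply, Finset.sum_eq_single i]
    · simp
    · intro j _ hj
      simp [Pi.single_eq_of_ne hj]
    · simp
  rw [← h1, adjoint_inner_right, rowOperator_single, adjoint_inner_right]

theorem isPartialIsometry_rowOperator_iff [CompleteSpace H] (T : Fin n → H →L[ℂ] H) :
    IsPartialIsometry (rowOperator T) ↔ ∀ i x, ∑ j, T j (adjoint (T j) (T i x)) = T i x := by
  have key : ∀ h, rowOperator T (adjoint (rowOperator T) h) = ∑ j, T j (adjoint (T j) h) := by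
    intro h
    simp only [rowOperator_apply, adjoint_rowOperator_apply]
  rw [isPartialIsometry_iff]
  simp only [key]
  constructor
  · intro h i x
    have := h (WithLp.toLp 2 (Pi.single i x))
    rwa [rowOperator_single] at this
  · intro h y
    rw [rowOperator_apply]
    simp only [map_sum]
    rw [Finset.sum_comm]
    exact Finset.sum_congr rfl fun i _ => h i _

theorem norm_sum_smul_le (z : EuclideanSpace ℂ (Fin n)) (y : PiLp 2 (fun _ : Fin n => H)) :
    ‖∑ i, z i • y i‖ ≤ ‖z‖ * ‖y‖ := by
  rw [EuclideanSpace.norm_eq, PiLp.norm_eq_of_L2]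
  refine (norm_sum_le _ _).trans ?_
  simp only [norm_smul]
  exact Real.sum_mul_le_sqrt_mul_sqrt _ _ _

end RowOperator

/-! ### The maps F_z and their intertwining relation -/

section ModelFunction

variable {n : ℕ} {H : Type*} [NormedAddCommGroup H] [InnerProductSpace ℂ H] [CompleteSpace H]

open ContinuousLinearMap

instance (T : Fin n → H →L[ℂ] H) : CompleteSpace (wanderingSubspace T) :=
  inferInstanceAs (CompleteSpace (rowOperator T).rangeᗮ)

/-- The operator `∑ i, z_i T_i^*`. -/
noncomputable def adjointPencil (T : Fin n → H →L[ℂ] H) (z : EuclideanSpace ℂ (Fin n)) :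
    H →L[ℂ] H :=
  ∑ i, z i • adjoint (T i)

/-- The map `x ↦ P_W (1 - ∑ i, z_i T_i^*)⁻¹ x`, where `P_W` is the orthogonal projection onto the
wandering subspace of `T`. -/
noncomputable def modelEval (T : Fin n → H →L[ℂ] H) (z : EuclideanSpace ℂ (Fin n)) :
    H →L[ℂ] wanderingSubspace T :=
  (wanderingSubspace T).orthogonalProjectionOnto ∘L Ring.inverse (1 - adjointPencil T z)

variable {T : Fin n → H →L[ℂ] H}

theorem adjointPencil_apply (z : EuclideanSpace ℂ (Fin n)) (x : H) :
    adjointPencil T z x = ∑ i, z i • adjoint (T i) x := by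
  simp [adjointPencil]

theorem adjointPencil_add (z w : EuclideanSpace ℂ (Fin n)) :
    adjointPencil T (z + w) = adjointPencil T z + adjointPencil T w := by
  simp [adjointPencil, add_smul, Finset.sum_add_distrib]

theorem adjointPencil_smul (c : ℂ) (z : EuclideanSpace ℂ (Fin n)) :
    adjointPencil T (c • z) = c • adjointPencil T z := by
  simp [adjointPencil, Finset.smul_sum, smul_smul]

theorem adjointPencil_single (i : Fin n) :
    adjointPencil T (EuclideanSpace.single i 1) = adjoint (T i) := by
  ext x
  simp [adjointPencil_apply]

theorem norm_adjointPencil_le (hT : IsPartialIsometry (rowOperator T))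
    (z : EuclideanSpace ℂ (Fin n)) : ‖adjointPencil T z‖ ≤ ‖z‖ := by
  refine opNorm_le_bound _ (norm_nonneg _) fun x => ?_
  have h := norm_sum_smul_le z (adjoint (rowOperator T) x)
  simp only [adjoint_rowOperator_apply] at h
  rw [adjointPencil_apply]
  exact h.trans (by gcongr; exact hT.norm_adjoint_apply_le x)

theorem isUnit_one_sub_adjointPencil (hT : IsPartialIsometry (rowOperator T))
    {z : EuclideanSpace ℂ (Fin n)} (hz : ‖z‖ < 1) : IsUnit (1 - adjointPencil T z) :=
  isUnit_one_sub_of_norm_lt_one ((norm_adjointPencil_le hT z).trans_lt hz)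

theorem adjoint_apply_of_mem_wanderingSubspace {x : H} (hx : x ∈ wanderingSubspace T)
    (i : Fin n) : adjoint (T i) x = 0 := by
  refine ext_inner_left ℂ fun v => ?_
  rw [adjoint_inner_right, inner_zero_right]
  refine (Submodule.mem_orthogonal _ _).mp hx _ ⟨WithLp.toLp 2 (Pi.single i v), ?_⟩
  exact rowOperator_single T i v

theorem modelEval_one_sub_apply (hT : IsPartialIsometry (rowOperator T))
    {z : EuclideanSpace ℂ (Fin n)} (hz : ‖z‖ < 1) (x : H) :
    modelEval T z (x - adjointPencil T z x) =
      (wanderingSubspace T).orthogonalProjectionOnto x := by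
  have h := Ring.inverse_mul_cancel _ (isUnit_one_sub_adjointPencil hT hz)
  have h2 : Ring.inverse (1 - adjointPencil T z) (x - adjointPencil T z x) = x :=
    DFunLike.congr_fun h x
  rw [modelEval, comp_apply, h2]

theorem modelEval_zero (x : H) :
    modelEval T 0 x = (wanderingSubspace T).orthogonalProjectionOnto x := by
  have : adjointPencil T 0 = 0 := by simp [adjointPencil]
  simp [modelEval, this]

theorem modelEval_coe (hT : IsPartialIsometry (rowOperator T))
    {z : EuclideanSpace ℂ (Fin n)} (hz : ‖z‖ < 1) (η : wanderingSubspace T) :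
    modelEval T z (η : H) = η := by
  have h := modelEval_one_sub_apply hT hz (η : H)
  have h2 : adjointPencil T z (η : H) = 0 := by
    simp [adjointPencil_apply, adjoint_apply_of_mem_wanderingSubspace η.2]
  simpa [h2] using h

/-- Solve (1 - A_z) x = (T - z) y and split x = Tb + w with w in W(T). With c = T^*Tb, the partial
isometry gives Tc = Tb, so (1 - A_z) Tb = (T - z) c. As A_z w = 0, w = (T - z)(y - c), and
disjointness forces w = 0. Thus x lies in the range of T and P_W x = 0. -/
theorem modelEval_rowOperator_translateTuple (hT : IsPartialIsometry (rowOperator T))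
    {z : EuclideanSpace ℂ (Fin n)} (hz : ‖z‖ < 1)
    (h0 : IsCompl (rowOperator T).range (wanderingSubspace T))
    (hdisj : Disjoint (rowOperator (translateTuple T z)).range (wanderingSubspace T))
    (y : PiLp 2 (fun _ : Fin n => H)) :
    modelEval T z (rowOperator (translateTuple T z) y) = 0 := by
  set v := rowOperator (translateTuple T z) y with hv
  have hPI := (isPartialIsometry_iff _).mp hT
  have hpencil : ∀ x, adjointPencil T z x = ∑ i, z i • adjoint (rowOperator T) x i := by
    intro x
    simp only [adjointPencil_apply, adjoint_rowOperator_apply]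
  obtain ⟨x, hx⟩ : ∃ x, x - adjointPencil T z x = v := by
    have h := DFunLike.congr_fun (Ring.mul_inverse_cancel _ (isUnit_one_sub_adjointPencil hT hz)) v
    exact ⟨Ring.inverse (1 - adjointPencil T z) v, by simpa using h⟩
  have hxtop : x ∈ (rowOperator T).range ⊔ wanderingSubspace T := by
    rw [h0.sup_eq_top]; trivial
  obtain ⟨a, ⟨b, rfl⟩, w, hw, rfl⟩ := Submodule.mem_sup.mp hxtop
  have hAw : adjointPencil T z w = 0 := by
    simp [adjointPencil_apply, adjoint_apply_of_mem_wanderingSubspace hw]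
  set c := adjoint (rowOperator T) (rowOperator T b) with hc
  have h1 : rowOperator T b - adjointPencil T z (rowOperator T b) =
      rowOperator (translateTuple T z) c := by
    rw [rowOperator_translateTuple_apply, hpencil, ← hc, hPI]
  have h2 : w = rowOperator (translateTuple T z) (y - c) := by
    have hx' : rowOperator T b + w - adjointPencil T z (rowOperator T b + w) = v := hx
    rw [map_add, hAw, add_zero, add_sub_right_comm, h1] at hx'
    rw [map_sub, ← hv, ← hx']
    abel
  have hw0 : w = 0 := Submodule.disjoint_def.mp hdisj w (h2 ▸ ⟨_, rfl⟩) hw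
  rw [← hx, modelEval_one_sub_apply hT hz, hw0, add_zero]
  refine Submodule.orthogonalProjectionOnto_apply_of_mem_orthogonal ?_
  exact Submodule.le_orthogonal_orthogonal _ ⟨b, rfl⟩

theorem convex_setOf_norm_smul_lt_one (z : EuclideanSpace ℂ (Fin n)) :
    Convex ℝ {t : ℂ | ‖t • z‖ < 1} := by
  have : {t : ℂ | ‖t • z‖ < 1} =
      ((LinearMap.toSpanSingleton ℂ _ z).restrictScalars ℝ) ⁻¹' Metric.ball 0 1 := by
    ext t; simp
  rw [this]
  exact (convex_ball 0 1).linear_preimage _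

theorem isOpen_setOf_norm_smul_lt_one (z : EuclideanSpace ℂ (Fin n)) :
    IsOpen {t : ℂ | ‖t • z‖ < 1} :=
  isOpen_lt (by fun_prop) continuous_const

theorem hasDerivAt_inverse_one_sub_adjointPencil (hT : IsPartialIsometry (rowOperator T))
    {z w : EuclideanSpace ℂ (Fin n)} {t : ℂ} (ht : ‖w + t • z‖ < 1) :
    HasDerivAt (fun s : ℂ => Ring.inverse (1 - adjointPencil T (w + s • z)))
      (Ring.inverse (1 - adjointPencil T (w + t • z)) * adjointPencil T z *
        Ring.inverse (1 - adjointPencil T (w + t • z))) t := by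
  obtain ⟨v, hv⟩ := isUnit_one_sub_adjointPencil hT ht
  have h1 : HasDerivAt (fun s : ℂ => 1 - adjointPencil T (w + s • z)) (-adjointPencil T z) t := by
    simp only [adjointPencil_add, adjointPencil_smul]
    simpa using (((hasDerivAt_id t).smul_const (adjointPencil T z)).const_add
      (adjointPencil T w)).const_sub 1
  have h2 := (hv ▸ hasFDerivAt_ringInverse (𝕜 := ℂ) v :
    HasFDerivAt Ring.inverse _ (1 - adjointPencil T (w + t • z))).comp_hasDerivAt t h1
  rw [← hv, Ring.inverse_unit]
  simpa [Function.comp_def] using h2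

theorem hasDerivAt_modelEval (hT : IsPartialIsometry (rowOperator T))
    {z w : EuclideanSpace ℂ (Fin n)} {t : ℂ} (ht : ‖w + t • z‖ < 1) (x : H) :
    HasDerivAt (fun s : ℂ => modelEval T (w + s • z) x)
      (modelEval T (w + t • z) (adjointPencil T z
        (Ring.inverse (1 - adjointPencil T (w + t • z)) x))) t := by
  have h := (hasDerivAt_inverse_one_sub_adjointPencil hT ht).clm_apply (hasDerivAt_const t x)
  have h2 := (wanderingSubspace T).orthogonalProjectionOnto.hasFDerivAt.comp_hasDerivAt t h
  simpa [modelEval, Function.comp_def] using h2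

/-- Regularity gives the relation only near 0; the identity theorem along the complex line t ↦ t • z
carries it to t = 1. -/
theorem modelEval_apply_eq_smul (hT : IsPartialIsometry (rowOperator T))
    (hreg : IsRegularAtZero T) {z : EuclideanSpace ℂ (Fin n)} (hz : ‖z‖ < 1) (i : Fin n) (x : H) :
    modelEval T z (T i x) = z i • modelEval T z x := by
  obtain ⟨ε, hε, hreg⟩ := hreg
  have h0 : IsCompl (rowOperator T).range (wanderingSubspace T) := by
    have h := (hreg 0 (by simpa using hε)).2
    rwa [translateTuple_zero] at h
  have hsmall : ∀ w : EuclideanSpace ℂ (Fin n), ‖w‖ < 1 → ‖w‖ < ε →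
      modelEval T w (T i x) - w i • modelEval T w x = 0 := by
    intro w hw1 hwε
    have h := modelEval_rowOperator_translateTuple hT hw1 h0 (hreg w hwε).2.disjoint
      (WithLp.toLp 2 (Pi.single i x))
    rw [rowOperator_single] at h
    simpa [translateTuple] using h
  have han : AnalyticOnNhd ℂ
      (fun t : ℂ => modelEval T (t • z) (T i x) - (t • z) i • modelEval T (t • z) x)
      {t : ℂ | ‖t • z‖ < 1} := by
    refine DifferentiableOn.analyticOnNhd (fun t ht => ?_) (isOpen_setOf_norm_smul_lt_one z)
    have hd : ∀ v, DifferentiableAt ℂ (fun s : ℂ => modelEval T (s • z) v) t := fun v => by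
      have := (hasDerivAt_modelEval (w := 0) (z := z) (t := t) hT
        (by simpa using ht) v).differentiableAt
      simpa using this
    have hcoord : DifferentiableAt ℂ (fun s : ℂ => (s • z) i) t := by
      simp only [PiLp.smul_apply, smul_eq_mul]
      fun_prop
    exact ((hd _).sub (hcoord.smul (hd _))).differentiableWithinAt
  have hev : (fun t : ℂ => modelEval T (t • z) (T i x) - (t • z) i • modelEval T (t • z) x)
      =ᶠ[nhds 0] 0 := by
    have hc : ∀ r : ℝ, 0 < r → ∀ᶠ t : ℂ in nhds 0, ‖t • z‖ < r := fun r hr => by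
      have : Continuous fun t : ℂ => ‖t • z‖ := by fun_prop
      exact (this.tendsto 0).eventually_lt_const (by simpa using hr)
    filter_upwards [hc 1 one_pos, hc ε hε] with t h1 h2
    exact hsmall _ h1 h2
  have h := han.eqOn_zero_of_preconnected_of_eventuallyEq_zero
    (convex_setOf_norm_smul_lt_one z).isPreconnected (z₀ := 0) (by simp) hev
    (show (1 : ℂ) ∈ {t : ℂ | ‖t • z‖ < 1} by simpa using hz)
  simpa [sub_eq_zero] using h

end ModelFunction

theorem one_sub_inner_ne_zero {E : Type*} [NormedAddCommGroup E] [InnerProductSpace ℂ E]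
    {w z : E} (hw : ‖w‖ < 1) (hz : ‖z‖ < 1) : (1 - inner ℂ w z : ℂ) ≠ 0 := by
  intro h
  have h1 : ‖(inner ℂ w z : ℂ)‖ < 1 := (norm_inner_le_norm _ _).trans_lt
    (mul_lt_one_of_nonneg_of_lt_one_left (norm_nonneg _) hw hz.le)
  rw [← sub_eq_zero.mp h] at h1
  simp at h1

/-! ### The reproducing kernel identity and the reducing subspace -/

section ModelKernel

variable {n : ℕ} {H : Type*} [NormedAddCommGroup H] [InnerProductSpace ℂ H] [CompleteSpace H]

open ContinuousLinearMap

theorem modelEval_adjoint_modelEval {T : Fin n → H →L[ℂ] H}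
    (hT : IsPartialIsometry (rowOperator T)) (hreg : IsRegularAtZero T)
    {z w : EuclideanSpace ℂ (Fin n)} (hz : ‖z‖ < 1) (hw : ‖w‖ < 1) (η : wanderingSubspace T) :
    modelEval T z (adjoint (modelEval T w) η) = (1 - inner ℂ w z)⁻¹ • η := by
  set k := adjoint (modelEval T w) η with hk
  -- This is the adjoint of F_w (1 - A_w) = P_W; applying F_z then turns each T_i into z_i.
  have h1 : k - ∑ i, star (w i) • T i k = η := by
    refine ext_inner_right ℂ fun v => ?_
    have h2 : inner ℂ (k - ∑ i, star (w i) • T i k) v = inner ℂ k (v - adjointPencil T w v) := by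
      simp [adjointPencil_apply, adjoint_inner_right, mul_comm]
    rw [h2, hk, adjoint_inner_left, modelEval_one_sub_apply hT hw,
      Submodule.inner_orthogonalProjectionOnto_eq_of_mem_left]
  have h3 := congrArg (modelEval T z) h1
  rw [modelEval_coe hT hz] at h3
  have h4 : (1 - inner ℂ w z : ℂ) • modelEval T z k = η := by
    rw [← h3, map_sub, map_sum, sub_smul, one_smul, PiLp.inner_apply, Finset.sum_smul]
    congr 1
    refine Finset.sum_congr rfl fun i _ => ?_
    rw [map_smul, modelEval_apply_eq_smul hT hreg hz, smul_smul]
    simp [mul_comm]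
  rw [← h4, smul_smul, inv_mul_cancel₀ (one_sub_inner_ne_zero hw hz), one_smul]

/-- The common kernel of the maps `modelEval T z` over the open unit ball. -/
noncomputable def modelKernel (T : Fin n → H →L[ℂ] H) : Submodule ℂ H :=
  ⨅ z : unitBall n, (modelEval T z.1).ker

variable {T : Fin n → H →L[ℂ] H}

theorem mem_modelKernel {x : H} :
    x ∈ modelKernel T ↔ ∀ z : EuclideanSpace ℂ (Fin n), ‖z‖ < 1 → modelEval T z x = 0 := by
  simp [modelKernel]

theorem isClosed_modelKernel : IsClosed (modelKernel T : Set H) := by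
  simp only [modelKernel, Submodule.coe_iInf]
  exact isClosed_iInter fun z => (modelEval T z.1).isClosed_ker

instance : CompleteSpace (modelKernel T) := isClosed_modelKernel.completeSpace_coe

theorem apply_mem_modelKernel (hT : IsPartialIsometry (rowOperator T))
    (hreg : IsRegularAtZero T) {x : H} (hx : x ∈ modelKernel T) (i : Fin n) :
    T i x ∈ modelKernel T := by
  rw [mem_modelKernel] at hx ⊢
  intro z hz
  rw [modelEval_apply_eq_smul hT hreg hz, hx z hz, smul_zero]

theorem adjoint_apply_mem_modelKernel (hcomm : IsCommutingTuple T)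
    (hT : IsPartialIsometry (rowOperator T)) {x : H} (hx : x ∈ modelKernel T) (i : Fin n) :
    adjoint (T i) x ∈ modelKernel T := by
  rw [mem_modelKernel] at hx ⊢
  -- Differentiate F_w x = 0 in w along the i-th basis vector.
  have hzero : ∀ w : EuclideanSpace ℂ (Fin n), ‖w‖ < 1 → modelEval T w
      (adjoint (T i) (Ring.inverse (1 - adjointPencil T w) x)) = 0 := by
    intro w hw
    have h1 := hasDerivAt_modelEval (z := EuclideanSpace.single i 1) (w := w) (t := 0) hT
      (by simpa using hw) x
    rw [zero_smul, add_zero, adjointPencil_single] at h1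
    refine h1.unique ((hasDerivAt_const (0 : ℂ) (0 : wanderingSubspace T)).congr_of_eventuallyEq ?_)
    have hc : Continuous fun s : ℂ => ‖w + s • EuclideanSpace.single i (1 : ℂ)‖ := by fun_prop
    filter_upwards [(hc.tendsto 0).eventually_lt_const (by simpa using hw)] with s hs
    exact hx _ hs
  have hcommute : ∀ w : EuclideanSpace ℂ (Fin n), ‖w‖ < 1 →
      Ring.inverse (1 - adjointPencil T w) (adjoint (T i) x) =
        adjoint (T i) (Ring.inverse (1 - adjointPencil T w) x) := by
    intro w hw
    obtain ⟨v, hv⟩ := isUnit_one_sub_adjointPencil hT hw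
    have h1 : Commute (adjoint (T i)) (v : H →L[ℂ] H) := by
      rw [hv]
      refine (Commute.one_right _).sub_right (Commute.sum_right _ _ _ fun j _ => ?_)
      refine Commute.smul_right ?_ _
      have := congrArg adjoint (hcomm j i)
      rwa [adjoint_comp, adjoint_comp] at this
    rw [← hv, Ring.inverse_unit]
    exact (DFunLike.congr_fun h1.units_inv_right.eq x).symm
  intro z hz
  -- The factor s makes φ'(s) equal F_{sz} (1 - A_{sz})⁻¹ T_i^* x, which vanishes by `hzero` and
  -- `hcommute`. So φ(1) = φ(0) = 0.
  set φ : ℂ → wanderingSubspace T := fun s => s • modelEval T (s • z) (adjoint (T i) x) with hφ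
  have hderiv : ∀ s ∈ {t : ℂ | ‖t • z‖ < 1}, HasDerivAt φ 0 s := by
    intro s hs
    have h1 := hasDerivAt_modelEval (w := 0) (z := z) (t := s) hT (by simpa using hs)
      (adjoint (T i) x)
    simp only [zero_add] at h1
    convert! (hasDerivAt_id s).smul h1 using 1
    have h2 := DFunLike.congr_fun (Ring.mul_inverse_cancel _ (isUnit_one_sub_adjointPencil hT hs))
      (adjoint (T i) x)
    have h3 : Ring.inverse (1 - adjointPencil T (s • z)) (adjoint (T i) x) -
        s • adjointPencil T z (Ring.inverse (1 - adjointPencil T (s • z)) (adjoint (T i) x)) =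
        adjoint (T i) x := by
      rw [← smul_apply, ← adjointPencil_smul]
      exact h2
    have h4 := hzero _ hs
    rw [← hcommute _ hs] at h4
    have h5 := congrArg (modelEval T (s • z)) h3
    rw [map_sub, h4, map_smul, zero_sub] at h5
    simp [← h5]
  have h := (isOpen_setOf_norm_smul_lt_one z).is_const_of_deriv_eq_zero
    (convex_setOf_norm_smul_lt_one z).isPreconnected
    (fun s hs => (hderiv s hs).differentiableAt.differentiableWithinAt)
    (fun s hs => (hderiv s hs).deriv)
    (show (1 : ℂ) ∈ {t : ℂ | ‖t • z‖ < 1} by simpa using hz)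
    (show (0 : ℂ) ∈ {t : ℂ | ‖t • z‖ < 1} by simp)
  simpa [hφ] using h

theorem apply_mem_orthogonal_of_adjoint {A : H →L[ℂ] H} {K : Submodule ℂ H}
    (h : ∀ x ∈ K, adjoint A x ∈ K) {y : H} (hy : y ∈ Kᗮ) : A y ∈ Kᗮ := by
  rw [Submodule.mem_orthogonal] at hy ⊢
  intro u hu
  rw [← adjoint_inner_left]
  exact hy _ (h u hu)

theorem sum_apply_adjoint_of_mem_modelKernel (hT : IsPartialIsometry (rowOperator T))
    (hclosed : IsClosed ((rowOperator T).range : Set H)) {x : H} (hx : x ∈ modelKernel T) :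
    ∑ i, T i (adjoint (T i) x) = x := by
  have h1 := mem_modelKernel.mp hx 0 (by simp)
  rw [modelEval_zero, Submodule.orthogonalProjectionOnto_eq_zero_iff] at h1
  have h2 : x ∈ (rowOperator T).range := by
    rw [← hclosed.submodule_topologicalClosure_eq,
      ← Submodule.orthogonal_orthogonal_eq_closure]
    exact h1
  obtain ⟨y, rfl⟩ := h2
  have h := (isPartialIsometry_iff _).mp hT y
  rw [rowOperator_apply T (adjoint _ _)] at h
  simp only [adjoint_rowOperator_apply] at h
  exact h

/-- The vectors F_z^* η are total in the complement of the common kernel and have the same Gram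
matrix as the kernel functions of the Drury–Arveson space. -/
theorem exists_unitary_orthogonal_modelKernel (hT : IsPartialIsometry (rowOperator T))
    (hreg : IsRegularAtZero T) :
    ∃ U : (modelKernel T)ᗮ ≃ₗᵢ[ℂ] DruryArvesonSpace n (wanderingSubspace T),
      ∀ x (z : unitBall n), U x z = modelEval T z.1 (x : H) := by
  have hnorm : ∀ z : unitBall n, ‖z.1‖ < 1 := fun z => mem_ball_zero_iff.mp z.2
  have hmem : ∀ (z : unitBall n) η, adjoint (modelEval T z.1) η ∈ (modelKernel T)ᗮ := by
    intro z η
    rw [Submodule.mem_orthogonal]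
    intro u hu
    rw [adjoint_inner_right, mem_modelKernel.mp hu _ (hnorm z), inner_zero_left]
  let κ : unitBall n × wanderingSubspace T → (modelKernel T)ᗮ := fun p =>
    ⟨adjoint (modelEval T p.1.1) p.2, hmem p.1 p.2⟩
  let k : unitBall n × wanderingSubspace T → DruryArvesonSpace n (wanderingSubspace T) := fun p =>
    RKHS.kerFun (DruryArvesonSpace n (wanderingSubspace T)) p.1 p.2
  have hκ : ∀ p x, inner ℂ (κ p) x = inner ℂ p.2 (modelEval T p.1.1 (x : H)) := by
    intro p x
    rw [Submodule.coe_inner, adjoint_inner_left]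
  have hk : ∀ p x, inner ℂ (k p) x = inner ℂ p.2 (x p.1) := fun p x => RKHS.kerFun_inner _ _ _
  obtain ⟨U, hU⟩ := exists_linearIsometryEquiv_of_inner_eq κ k
    (fun x hx => by
      have h1 : (x : H) ∈ modelKernel T := mem_modelKernel.mpr fun z hz =>
        ext_inner_left ℂ fun η => by
          rw [← hκ ⟨⟨z, mem_ball_zero_iff.mpr hz⟩, η⟩, hx, inner_zero_right]
      exact Subtype.ext (Submodule.disjoint_def.mp (modelKernel T).orthogonal_disjoint _ h1 x.2))
    (fun x hx => RKHS.ext fun z => ext_inner_left ℂ fun η => by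
      rw [← hk ⟨z, η⟩, hx]; simp)
    (fun p q => by
      rw [hκ, hk, RKHS.kerFun_apply, RKHS.OfKernel.kernel_ofKernel]
      simp only [κ]
      rw [modelEval_adjoint_modelEval hT hreg (hnorm _) (hnorm _)]
      simp [druryArvesonKernel])
  refine ⟨U, fun x z => ext_inner_left ℂ fun η => ?_⟩
  rw [← hk ⟨z, η⟩, ← hκ ⟨z, η⟩, ← hU, U.inner_map_map]

end ModelKernel

/-! ### Reducing subspaces and the converse -/

section Decomposition

variable {n : ℕ} {H : Type*} [NormedAddCommGroup H] [InnerProductSpace ℂ H] [CompleteSpace H]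

open ContinuousLinearMap

theorem adjoint_restrict_apply {A : H →L[ℂ] H} {K : Submodule ℂ H} [CompleteSpace K]
    {B : K →L[ℂ] K} (hB : ∀ x : K, A x = B x) (hK : ∀ y ∈ Kᗮ, A y ∈ Kᗮ) (x : K) :
    adjoint A x = (adjoint B x : K) := by
  refine ext_inner_right ℂ fun v => ?_
  obtain ⟨a, ha, b, hb, rfl⟩ := K.exists_add_mem_mem_orthogonal v
  rw [adjoint_inner_left, map_add, inner_add_right, inner_add_right,
    Submodule.inner_right_of_mem_orthogonal x.2 (hK b hb),
    Submodule.inner_right_of_mem_orthogonal (adjoint B x).2 hb, hB ⟨a, ha⟩]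
  exact congrArg (· + 0) (adjoint_inner_left B ⟨a, ha⟩ x).symm

theorem IsUnitarilyEquivalentToShift.sum_apply_adjoint_apply {E D : Type*} [NormedAddCommGroup E]
    [InnerProductSpace ℂ E] [CompleteSpace E] [NormedAddCommGroup D] [InnerProductSpace ℂ D]
    [CompleteSpace D] {S : Fin n → E →L[ℂ] E} (hS : IsUnitarilyEquivalentToShift S D) (i : Fin n)
    (x : E) : ∑ j, S j (adjoint (S j) (S i x)) = S i x := by
  obtain ⟨U, hU⟩ := hS
  let κ : unitBall n → D → E := fun w η => U.symm (RKHS.kerFun (DruryArvesonSpace n D) w η)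
  have hκ : ∀ w η y, inner ℂ (κ w η) y = inner ℂ η (U y w) := fun w η y => by
    rw [← RKHS.kerFun_inner, ← U.inner_map_map, U.apply_symm_apply]
  have htotal : ∀ y y', (∀ w η, inner ℂ (κ w η) y = inner ℂ (κ w η) y') → y = y' :=
    fun y y' h => U.injective <| RKHS.ext fun w => ext_inner_left ℂ fun η => by
      rw [← hκ, ← hκ, h]
  have hadj : ∀ j w η, adjoint (S j) (κ w η) = star (w.1 j) • κ w η := fun j w η =>
    ext_inner_right ℂ fun y => by
      rw [adjoint_inner_left, hκ, hU, inner_smul_right, inner_smul_left, hκ]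
      simp
  let o : unitBall n := ⟨0, by simp⟩
  -- Since q / (1 - q) = 1 / (1 - q) - 1, the defect 1 - ∑ S_j S_j^* sends the kernel vector at w to
  -- the one at the origin, which is orthogonal to every S_i x because z_i vanishes there.
  have hsum : ∀ w η, ∑ j, S j (adjoint (S j) (κ w η)) = κ w η - κ o η := by
    intro w η
    refine U.injective (RKHS.ext fun z => ?_)
    have hker : ∀ w' : unitBall n, U (κ w' η) z = (1 - inner ℂ w'.1 z.1)⁻¹ • η := fun w' => by
      rw [U.apply_symm_apply, RKHS.kerFun_apply, RKHS.OfKernel.kernel_ofKernel]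
      rfl
    have hne := one_sub_inner_ne_zero (mem_ball_zero_iff.mp w.2) (mem_ball_zero_iff.mp z.2)
    have h1 : ∑ j, S j (adjoint (S j) (κ w η)) = ∑ j, star (w.1 j) • S j (κ w η) := by
      simp only [hadj, map_smul]
    have h2 : ∀ f : Fin n → DruryArvesonSpace n D, (∑ j, f j) z = ∑ j, f j z := fun f => by
      rw [← RKHS.coeCLM_apply, map_sum, Finset.sum_apply]
      rfl
    rw [h1, map_sum, h2, map_sub, RKHS.coe_sub, Pi.sub_apply, hker, hker]
    simp only [map_smul, RKHS.coe_smul, Pi.smul_apply, hU, hker, smul_smul]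
    rw [← Finset.sum_smul, ← sub_smul]
    congr 1
    have h3 : ∑ j, star (w.1 j) * (z.1 j * (1 - inner ℂ w.1 z.1)⁻¹) =
        inner ℂ w.1 z.1 * (1 - inner ℂ w.1 z.1)⁻¹ := by
      rw [PiLp.inner_apply, Finset.sum_mul]
      refine Finset.sum_congr rfl fun j _ => ?_
      simp only [RCLike.inner_apply, RCLike.star_def]
      ring
    have h4 : (inner ℂ o.1 z.1 : ℂ) = 0 := inner_zero_left _
    rw [h3, h4]
    field_simp
    ring
  refine htotal _ _ fun w η => ?_
  have h6 : inner ℂ (κ w η) (∑ j, S j (adjoint (S j) (S i x))) =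
      inner ℂ (∑ j, S j (adjoint (S j) (κ w η))) (S i x) := by
    rw [inner_sum, sum_inner]
    refine Finset.sum_congr rfl fun j _ => ?_
    rw [← adjoint_inner_left, adjoint_inner_right]
  rw [h6, hsum, inner_sub_left, hκ o, hU]
  simp [o]

theorem sum_apply_adjoint_apply_of_isOrthogonalDirectSum {T : Fin n → H →L[ℂ] H}
    {H₀ : Submodule ℂ H} [CompleteSpace H₀] {T₀ : Fin n → H₀ →L[ℂ] H₀}
    {T₁ : Fin n → H₀ᗮ →L[ℂ] H₀ᗮ} (h : IsOrthogonalDirectSum T H₀ T₀ T₁)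
    (h₀ : ∀ i x, ∑ j, T₀ j (adjoint (T₀ j) (T₀ i x)) = T₀ i x)
    (h₁ : ∀ i x, ∑ j, T₁ j (adjoint (T₁ j) (T₁ i x)) = T₁ i x) (i : Fin n) (x : H) :
    ∑ j, T j (adjoint (T j) (T i x)) = T i x := by
  have hT₀ : ∀ i (x : H₀), T i x = T₀ i x := fun i x => by simpa using h i x 0
  have hT₁ : ∀ i (x : H₀ᗮ), T i x = T₁ i x := fun i x => by simpa using h i 0 x
  have hT₀' : ∀ i (x : H₀), adjoint (T i) x = (adjoint (T₀ i) x : H₀) := fun i =>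
    adjoint_restrict_apply (hT₀ i) fun y hy => by
      rw [hT₁ i ⟨y, hy⟩]; exact Subtype.prop _
  have hT₁' : ∀ i (x : H₀ᗮ), adjoint (T i) x = (adjoint (T₁ i) x : H₀ᗮ) := fun i =>
    adjoint_restrict_apply (hT₁ i) fun y hy => by
      rw [Submodule.orthogonal_orthogonal] at hy ⊢
      rw [hT₀ i ⟨y, hy⟩]; exact Subtype.prop _
  obtain ⟨a, ha, b, hb, rfl⟩ := H₀.exists_add_mem_mem_orthogonal x
  have e₀ := congrArg (Subtype.val) (h₀ i ⟨a, ha⟩)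
  have e₁ := congrArg (Subtype.val) (h₁ i ⟨b, hb⟩)
  simp only [Submodule.coe_sum, ← hT₀, ← hT₀', ← hT₁, ← hT₁'] at e₀ e₁
  simp only [map_add, Finset.sum_add_distrib, e₀, e₁]

end Decomposition

/-! ### The characterization -/

open ContinuousLinearMap in
theorem mainTheorem2 {n : ℕ} {H : Type u} [NormedAddCommGroup H] [InnerProductSpace ℂ H]
    [CompleteSpace H] (T : Fin n → H →L[ℂ] H) (hcomm : IsCommutingTuple T)
    (hreg : IsRegularAtZero T) :
    IsPartialIsometry (rowOperator T) ↔
      ∃ (H₀ : Submodule ℂ H) (_ : CompleteSpace H₀)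
        (T₀ : Fin n → H₀ →L[ℂ] H₀) (T₁ : Fin n → H₀ᗮ →L[ℂ] H₀ᗮ),
        IsOrthogonalDirectSum T H₀ T₀ T₁ ∧
        IsSphericalCoisometry T₀ ∧
        ∃ (D : Type u) (_ : NormedAddCommGroup D) (_ : InnerProductSpace ℂ D)
          (_ : CompleteSpace D), IsUnitarilyEquivalentToShift T₁ D := by
  constructor
  · intro hT
    have hmem₀ : ∀ i (x : modelKernel T), T i x ∈ modelKernel T := fun i x =>
      apply_mem_modelKernel hT hreg x.2 i
    have hmem₁ : ∀ i, ∀ y ∈ (modelKernel T)ᗮ, T i y ∈ (modelKernel T)ᗮ := fun i y hy =>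
      apply_mem_orthogonal_of_adjoint
        (fun x hx => adjoint_apply_mem_modelKernel hcomm hT hx i) hy
    let T₀ : Fin n → modelKernel T →L[ℂ] modelKernel T := fun i =>
      (T i ∘L (modelKernel T).subtypeL).codRestrict _ (hmem₀ i)
    let T₁ : Fin n → (modelKernel T)ᗮ →L[ℂ] (modelKernel T)ᗮ := fun i =>
      (T i ∘L (modelKernel T)ᗮ.subtypeL).codRestrict _ fun y => hmem₁ i y y.2
    have hT₀ : ∀ i (x : modelKernel T), T i x = T₀ i x := fun _ _ => rfl
    have hcomm₀ : IsCommutingTuple T₀ := fun i j => by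
      ext x
      exact DFunLike.congr_fun (hcomm i j) (x : H)
    refine ⟨modelKernel T, inferInstance, T₀, T₁, fun i x y => map_add _ _ _,
      ⟨hcomm₀, fun i j => ?_, ?_⟩, wanderingSubspace T, inferInstance, inferInstance,
      inferInstance, ?_⟩
    · rw [← adjoint_comp, ← adjoint_comp, hcomm₀]
    · ext x
      have hclosed : IsClosed ((rowOperator T).range : Set H) := by
        obtain ⟨ε, hε, hreg⟩ := hreg
        have h := (hreg 0 (by simpa using hε)).1
        rwa [translateTuple_zero] at h
      have h := sum_apply_adjoint_of_mem_modelKernel hT hclosed x.2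
      simp only [adjoint_restrict_apply (hT₀ _) (hmem₁ _), hT₀] at h
      simpa only [adjoint_adjoint, sum_apply, comp_apply, Submodule.coe_sum, id_apply] using h
    · obtain ⟨U, hU⟩ := exists_unitary_orthogonal_modelKernel hT hreg
      refine ⟨U, fun i x z => ?_⟩
      rw [hU, hU]
      exact modelEval_apply_eq_smul hT hreg (mem_ball_zero_iff.mp z.2) i x
  · rintro ⟨H₀, _, T₀, T₁, hsum, ⟨-, -, hT₀⟩, D, _, _, _, hT₁⟩
    rw [isPartialIsometry_rowOperator_iff]
    refine sum_apply_adjoint_apply_of_isOrthogonalDirectSum hsum (fun i x => ?_)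
      hT₁.sum_apply_adjoint_apply
    simpa using DFunLike.congr_fun hT₀ (T₀ i x)
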